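/- For a Boolean function $f\colon \mathbb{Z}_2^n \to \mathbb{Z}_2$, let $\mathrm{BHSP}_f$ be the following problem: given a complete description of $f$ and oracle access to the shifted function $f_s(x) = f(x+s)$ for an unknown $s \in \mathbb{Z}_2^n$, determine $s$. A quantum algorithm making $T$ queries starts from a fixed state (on a control bit $b$, a register $x \in \mathbb{Z}_2^n$ and a finite-dimensional workspace), alternates $T$ uses of the controlled phase oracle $|b,x\rangle \mapsto (-1)^{b f(x+s)}|b,x\rangle$ with arbitrary unitaries independent of $s$, and finally measures. It solves $\mathrm{BHSP}_f$ with error $\varepsilon$ if for every $s$ it outputs $s$ with probability at least $1-\varepsilon$. Let $Q_\varepsilon(\mathrm{BHSP}_f)$ be the least $T$ for which such an algorithm exists. Let $N = 2^n$ and $|f| = |\{x \in \mathbb{Z}_2^n : f(x) = 1\}|$. **Theorem.** For every $\varepsilon \in [0, 1/2)$ (for instance $\varepsilon = 1/3$) there is a constant $c > 0$, depending only on $\varepsilon$, such that for every $n \geq 1$ and every $f\colon \mathbb{Z}_2^n \to \mathbb{Z}_2$ with no undetectable shifts (that is, there is no $s \neq 0$ with $f(x+s) = f(x)$ for all $x$),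 $$Q_\varepsilon(\mathrm{BHSP}_f) \;\geq\; c \sqrt{N/|f|}.$$ In other words, the bounded-error quantum query complexity of $\mathrm{BHSP}_f$ is $\Omega(\sqrt{N/|f|})$. -/

import Mathlib

open scoped ENNReal

noncomputable section

namespace BHSP

/-- The group `ℤ₂ⁿ` of bit strings of length `n`. -/
abbrev Cube (n : ℕ) : Type := Fin n → ZMod 2

/-- The Hamming weight `|f|`: the number of inputs on which `f` takes the value `1`. -/
def hammingWeight {n : ℕ} (f : Cube n → ZMod 2) : ℕ :=
  (Finset.univ.filter fun x => f x = 1).card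

/-- `s` is an undetectable shift of `f` (a `0`-shift): `f (x + s) = f x` for all `x`. -/
def IsUndetectableShift {n : ℕ} (f : Cube n → ZMod 2) (s : Cube n) : Prop :=
  ∀ x, f (x + s) = f x

/-- `f` has no undetectable shifts, apart from the trivial shift `0`. -/
def NoUndetectableShifts {n : ℕ} (f : Cube n → ZMod 2) : Prop :=
  ∀ s, s ≠ 0 → ¬ IsUndetectableShift f s

/-- Labels `(b, x, w)` of the computational basis: control bit, query register, and a
workspace of dimension `m`. -/
abbrev Label (n m : ℕ) : Type := ZMod 2 × Cube n × Fin m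

/-- State space of an algorithm with workspace dimension `m`. -/
abbrev State (n m : ℕ) : Type := EuclideanSpace ℂ (Label n m)

/-- The controlled phase oracle `|b, x, w⟩ ↦ (-1)^(b g(x)) |b, x, w⟩` of `g : ℤ₂ⁿ → ℤ₂`. -/
def phaseOracle {n m : ℕ} (g : Cube n → ZMod 2) (ψ : State n m) : State n m :=
  WithLp.toLp 2 fun i => (-1 : ℂ) ^ (i.1 * g i.2.1).val * ψ i

/-- A quantum query algorithm whose oracle is a function `ℤ₂ⁿ → ℤ₂` and whose output is an
element of `ℤ₂ⁿ`. A `T`-query run prepares `init` (which may be any unit vector, so it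
absorbs a unitary before the first query), applies `oracle, gate 0, oracle, gate 1, …,
oracle, gate (T - 1)`, measures in the computational basis and
returns the image of the measured label under `output`. -/
structure QueryAlgorithm (n : ℕ) where
  /-- dimension of the workspace -/
  dim : ℕ
  /-- initial state -/
  init : State n dim
  norm_init : ‖init‖ = 1
  /-- the unitary applied directly after the `k`-th query, counted from `0` -/
  gate : ℕ → State n dim ≃ₗᵢ[ℂ] State n dim
  /-- classical post-processing of the measured label -/
  output : Label n dim → Cube n

/-- The state after `T` queries to the oracle of `g`, each followed by its gate. -/
def QueryAlgorithm.state {n : ℕ} (A : QueryAlgorithm n) (g : Cube n → ZMod 2) :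
    ℕ → State n A.dim
  | 0 => A.init
  | T + 1 => A.gate T (phaseOracle g (A.state g T))

/-- The probability that `A`, run with `T` queries to the oracle of `g`, outputs `r`. -/
def QueryAlgorithm.outputProb {n : ℕ} (A : QueryAlgorithm n) (g : Cube n → ZMod 2) (T : ℕ)
    (r : Cube n) : ℝ :=
  ∑ i ∈ Finset.univ.filter (fun i => A.output i = r), ‖A.state g T i‖ ^ 2

/-- `A` solves the hidden shift problem of `f` with `T` queries and error at most `ε`: for
every hidden shift `s`, given the oracle of `x ↦ f (x + s)`, it outputs `s` with
probability at least `1 - ε`. The algorithm may depend on `f` but not on `s`. -/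
def QueryAlgorithm.Solves {n : ℕ} (A : QueryAlgorithm n) (f : Cube n → ZMod 2) (T : ℕ)
    (ε : ℝ) : Prop :=
  ∀ s : Cube n, 1 - ε ≤ A.outputProb (fun x => f (x + s)) T s

/-- The quantum query complexity with error `ε` of the Boolean hidden shift problem of `f`:
the least number of queries of an algorithm that solves it (`⊤` if there is none). -/
def queryComplexity {n : ℕ} (f : Cube n → ZMod 2) (ε : ℝ) : ℕ∞ :=
  ⨅ (T : ℕ) (_ : ∃ A : QueryAlgorithm n, A.Solves f T ε), (T : ℕ∞)

end BHSP

end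

namespace BHSP

variable {n m : ℕ}

/-! Hybrid argument averaged over all `N = 2 ^ n` shifts, with the zero oracle as reference. The
reference run is independent of `s`, so its success probabilities sum to `1` and their square roots
to at most `√N` (`sum_sqrt_outputProb_le`). Each query adds at most `2√(N|f|)` to the summed
distance between the true runs and the reference (`sum_norm_state_shift_sub_le`). Hence `N√(1-ε) ≤
√N + 2T√(N|f|)`, up to the factor `√N` the content of `Solves.sqrt_le`. -/

lemma phaseOracle_zero (ψ : State n m) : phaseOracle (fun _ => 0) ψ = ψ := by
  ext i
  simp [phaseOracle]

lemma phaseOracle_sub (g : Cube n → ZMod 2) (φ ψ : State n m) :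
    phaseOracle g φ - phaseOracle g ψ = phaseOracle g (φ - ψ) := by
  ext i
  simp [phaseOracle, mul_sub]

lemma norm_phaseOracle (g : Cube n → ZMod 2) (ψ : State n m) :
    ‖phaseOracle g ψ‖ = ‖ψ‖ := by
  simp [phaseOracle, EuclideanSpace.norm_eq]

/-- The oracle of `g` changes a state only on labels whose query lies in the support of `g`. -/
lemma norm_phaseOracle_sub_self_sq_le (g : Cube n → ZMod 2) (ψ : State n m) :
    ‖phaseOracle g ψ - ψ‖ ^ 2 ≤ ∑ i, (if g i.2.1 = 1 then 4 * ‖ψ i‖ ^ 2 else 0) := by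
  rw [EuclideanSpace.norm_sq_eq]
  refine Finset.sum_le_sum fun i _ => ?_
  by_cases h : g i.2.1 = 1
  · have h2 : ‖(phaseOracle g ψ - ψ) i‖ ≤ 2 * ‖ψ i‖ := by
      calc ‖(phaseOracle g ψ - ψ) i‖ ≤ ‖phaseOracle g ψ i‖ + ‖ψ i‖ := norm_sub_le _ _
        _ = 2 * ‖ψ i‖ := by simp [phaseOracle, two_mul]
    rw [if_pos h]
    calc ‖(phaseOracle g ψ - ψ) i‖ ^ 2 ≤ (2 * ‖ψ i‖) ^ 2 := by gcongr
      _ = 4 * ‖ψ i‖ ^ 2 := by ring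
  · have h0 : g i.2.1 = 0 := by
      generalize g i.2.1 = a at h
      revert h
      decide +revert
    simp [phaseOracle, h0]

lemma sum_shift_ite (f : Cube n → ZMod 2) (x : Cube n) (a : ℝ) :
    ∑ s, (if f (x + s) = 1 then a else 0) = hammingWeight f * a := by
  refine (Equiv.sum_comp (Equiv.addLeft x) fun y => if f y = 1 then a else 0).trans ?_
  rw [← Finset.sum_filter, Finset.sum_const, nsmul_eq_mul, hammingWeight]

lemma card_cube : (Fintype.card (Cube n) : ℝ) = 2 ^ n := by
  simp [Cube, ZMod.card]

/-- Cauchy–Schwarz over the cube. -/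
lemma sum_le_sqrt_mul_sum_sq (u : Cube n → ℝ) {B : ℝ} (h : ∑ s, u s ^ 2 ≤ B) :
    ∑ s, u s ≤ √((2 : ℝ) ^ n * B) := by
  refine Real.le_sqrt_of_sq_le ?_
  calc (∑ s, u s) ^ 2 ≤ (Fintype.card (Cube n) : ℝ) * ∑ s, u s ^ 2 := by
        simpa using sq_sum_le_card_mul_sum_sq (s := Finset.univ) (f := u)
    _ ≤ (2 : ℝ) ^ n * B := by rw [card_cube]; gcongr

/-- The total displacement of a unit vector by the oracles of all shifts of `f`. -/
lemma sum_norm_phaseOracle_shift_sub_self_le (f : Cube n → ZMod 2) (ψ : State n m)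
    (hψ : ‖ψ‖ = 1) :
    ∑ s, ‖phaseOracle (fun x => f (x + s)) ψ - ψ‖ ≤ 2 * √((2 : ℝ) ^ n * hammingWeight f) := by
  have h : ∑ s, ‖phaseOracle (fun x => f (x + s)) ψ - ψ‖ ^ 2 ≤ hammingWeight f * 4 := by
    refine (Finset.sum_le_sum fun s _ =>
      norm_phaseOracle_sub_self_sq_le (fun x => f (x + s)) ψ).trans (le_of_eq ?_)
    -- For a fixed label, exactly `|f|` shifts move its query into the support.
    rw [Finset.sum_comm]
    simp_rw [sum_shift_ite]
    rw [← Finset.mul_sum, ← Finset.mul_sum, ← EuclideanSpace.norm_sq_eq, hψ]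
    ring
  refine (sum_le_sqrt_mul_sum_sq _ h).trans (le_of_eq ?_)
  rw [← mul_assoc, Real.sqrt_mul (by positivity) 4, mul_comm,
    show (4 : ℝ) = 2 ^ 2 by norm_num, Real.sqrt_sq zero_le_two]

namespace QueryAlgorithm

lemma norm_state (A : QueryAlgorithm n) (g : Cube n → ZMod 2) (T : ℕ) :
    ‖A.state g T‖ = 1 := by
  induction T with
  | zero => exact A.norm_init
  | succ T ih => rw [state, LinearIsometryEquiv.norm_map, norm_phaseOracle, ih]

/-- The gate and the oracle of `g` preserve the distance already accumulated; the new error is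
measured on the reference state, which does not depend on `g`. This independence permits summing
over shifts. -/
lemma norm_state_succ_sub_le (A : QueryAlgorithm n) (g : Cube n → ZMod 2) (T : ℕ) :
    ‖A.state g (T + 1) - A.state (fun _ => 0) (T + 1)‖ ≤
      ‖A.state g T - A.state (fun _ => 0) T‖ +
        ‖phaseOracle g (A.state (fun _ => 0) T) - A.state (fun _ => 0) T‖ := by
  rw [state, state, ← map_sub, LinearIsometryEquiv.norm_map, phaseOracle_zero,
    ← norm_phaseOracle g (A.state g T - _), ← phaseOracle_sub]
  exact norm_sub_le_norm_sub_add_norm_sub _ _ _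

/-- The total distance of the runs on the shifts of `f` from the run on the zero oracle. -/
lemma sum_norm_state_shift_sub_le (A : QueryAlgorithm n) (f : Cube n → ZMod 2) (T : ℕ) :
    ∑ s, ‖A.state (fun x => f (x + s)) T - A.state (fun _ => 0) T‖ ≤
      T * (2 * √((2 : ℝ) ^ n * hammingWeight f)) := by
  induction T with
  | zero => simp [state]
  | succ T ih =>
    refine (Finset.sum_le_sum fun s _ =>
      A.norm_state_succ_sub_le (fun x => f (x + s)) T).trans ?_
    rw [Finset.sum_add_distrib]
    have h := sum_norm_phaseOracle_shift_sub_self_le f _ (A.norm_state (fun _ => 0) T)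
    push_cast
    linarith

lemma outputProb_nonneg (A : QueryAlgorithm n) (g : Cube n → ZMod 2) (T : ℕ) (r : Cube n) :
    0 ≤ A.outputProb g T r :=
  Finset.sum_nonneg fun _ _ => by positivity

lemma sum_outputProb (A : QueryAlgorithm n) (g : Cube n → ZMod 2) (T : ℕ) :
    ∑ r, A.outputProb g T r = 1 := by
  simp only [outputProb]
  rw [Finset.sum_fiberwise, ← EuclideanSpace.norm_sq_eq, norm_state, one_pow]

/-- Output `r` corresponds to a coordinate projection, so norm inequalities apply. -/
lemma sqrt_outputProb_eq_norm (A : QueryAlgorithm n) (g : Cube n → ZMod 2) (T : ℕ)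
    (r : Cube n) :
    √(A.outputProb g T r) =
      ‖(WithLp.toLp 2 fun i => if A.output i = r then A.state g T i else 0 :
        State n A.dim)‖ := by
  rw [EuclideanSpace.norm_eq, outputProb, Finset.sum_filter]
  congr 1
  refine Finset.sum_congr rfl fun i _ => ?_
  by_cases h : A.output i = r <;> simp [h]

/-- Square roots of output probabilities are `1`-Lipschitz in the final state. -/
lemma sqrt_outputProb_le (A : QueryAlgorithm n) (g h : Cube n → ZMod 2) (T : ℕ)
    (r : Cube n) :
    √(A.outputProb g T r) ≤ √(A.outputProb h T r) + ‖A.state g T - A.state h T‖ := by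
  rw [sqrt_outputProb_eq_norm, sqrt_outputProb_eq_norm, ← sub_le_iff_le_add']
  refine (norm_sub_norm_le _ _).trans ?_
  rw [EuclideanSpace.norm_eq, EuclideanSpace.norm_eq]
  refine Real.sqrt_le_sqrt (Finset.sum_le_sum fun i _ => ?_)
  by_cases hi : A.output i = r
  · simp [hi]
  · simp [hi]

lemma sum_sqrt_outputProb_le (A : QueryAlgorithm n) (g : Cube n → ZMod 2) (T : ℕ) :
    ∑ r, √(A.outputProb g T r) ≤ √((2 : ℝ) ^ n) := by
  have h : ∑ r, √(A.outputProb g T r) ^ 2 ≤ 1 := by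
    simp_rw [Real.sq_sqrt (A.outputProb_nonneg g T _)]
    exact (A.sum_outputProb g T).le
  simpa using sum_le_sqrt_mul_sum_sq _ h

lemma Solves.sqrt_le {A : QueryAlgorithm n} {f : Cube n → ZMod 2} {T : ℕ} {ε : ℝ}
    (hA : A.Solves f T ε) :
    √((2 : ℝ) ^ n) * √(1 - ε) ≤ 1 + T * (2 * √(hammingWeight f : ℝ)) := by
  have hN : 0 < √((2 : ℝ) ^ n) := by positivity
  refine le_of_mul_le_mul_left ?_ hN
  calc √((2 : ℝ) ^ n) * (√((2 : ℝ) ^ n) * √(1 - ε))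
      = ∑ _s : Cube n, √(1 - ε) := by
        rw [← mul_assoc, Real.mul_self_sqrt (by positivity), Finset.sum_const, nsmul_eq_mul,
          Finset.card_univ, card_cube]
    _ ≤ ∑ s : Cube n, (√(A.outputProb (fun _ => 0) T s) +
          ‖A.state (fun x => f (x + s)) T - A.state (fun _ => 0) T‖) :=
        Finset.sum_le_sum fun s _ =>
          (Real.sqrt_le_sqrt (hA s)).trans (A.sqrt_outputProb_le _ _ T s)
    _ ≤ √((2 : ℝ) ^ n) + T * (2 * √((2 : ℝ) ^ n * hammingWeight f)) := by
        rw [Finset.sum_add_distrib]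
        exact add_le_add (A.sum_sqrt_outputProb_le _ T) (A.sum_norm_state_shift_sub_le f T)
    _ = √((2 : ℝ) ^ n) * (1 + T * (2 * √(hammingWeight f : ℝ))) := by
        rw [Real.sqrt_mul (by positivity)]
        ring

lemma Solves.le_queries {A : QueryAlgorithm n} {f : Cube n → ZMod 2} {T : ℕ} {ε : ℝ}
    (hA : A.Solves f T ε) (hn : 1 ≤ n) :
    (√(1 - ε) - √(1 / 2)) / 2 * √((2 : ℝ) ^ n / hammingWeight f) ≤ T := by
  rcases Nat.eq_zero_or_pos (hammingWeight f) with h0 | hpos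
  -- Division by zero gives `0`, so the bound is trivial here.
  · simp [h0]
  have hw : 0 < √(hammingWeight f : ℝ) := Real.sqrt_pos.2 (by exact_mod_cast hpos)
  -- Since `N ≥ 2`, the additive `1` in `Solves.sqrt_le` is at most `√N * √(1/2)`; this is the
  -- source of the `√(1/2)` in the constant.
  have hhalf : 1 ≤ √((2 : ℝ) ^ n) * √(1 / 2) := by
    rw [← Real.sqrt_mul (by positivity), Real.one_le_sqrt]
    have : (2 : ℝ) ^ 1 ≤ 2 ^ n := pow_le_pow_right₀ one_le_two hn
    linarith
  have h := hA.sqrt_le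
  rw [Real.sqrt_div (x := (2 : ℝ) ^ n) (by positivity), mul_div_assoc', div_le_iff₀ hw]
  linarith

end QueryAlgorithm

end BHSP

theorem mainTheorem5 (ε : ℝ) (hε₀ : 0 ≤ ε) (hε : ε < 1 / 2) :
    ∃ c : ℝ, 0 < c ∧ ∀ (n : ℕ), 1 ≤ n → ∀ f : BHSP.Cube n → ZMod 2,
      BHSP.NoUndetectableShifts f →
        ENNReal.ofReal (c * Real.sqrt ((2 : ℝ) ^ n / (BHSP.hammingWeight f : ℝ))) ≤
          ((BHSP.queryComplexity f ε : ℕ∞) : ℝ≥0∞) := by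
  refine ⟨(√(1 - ε) - √(1 / 2)) / 2, ?_, fun n hn f _ => ?_⟩
  · exact half_pos (sub_pos.2 (Real.sqrt_lt_sqrt (by norm_num) (by linarith)))
  -- Rounding up keeps the comparison with the infimum inside `ℕ∞`.
  · have h : (⌈(√(1 - ε) - √(1 / 2)) / 2 * √((2 : ℝ) ^ n / BHSP.hammingWeight f)⌉₊ : ℕ∞) ≤
        BHSP.queryComplexity f ε :=
      le_iInf₂ fun T ⟨_, hA⟩ => by exact_mod_cast Nat.ceil_le.2 (hA.le_queries hn)
    refine le_trans ?_ (ENat.toENNReal_le.2 h)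
    rw [ENat.toENNReal_coe]
    exact ENNReal.ofReal_le_natCast.2 (Nat.le_ceil _)
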